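/- Write $e(t)=\exp(2\pi i t)$. Call a real number $\alpha$ Liouville if for every $n\in\mathbb{N}$ there are integers $p,q$ with $q>1$ and $|\alpha-p/q|\le q^{-n}$ (so every rational number is Liouville in this sense), and non-Liouville otherwise. Let $P\in\mathbb{R}[x]$ be a polynomial whose coefficient of $x$ is non-Liouville. Then there are real constants $\tau,\rho,X_0>0$, depending only on $P$, such that $$\Bigl|\sum_{1\le x\le X} e\Bigl(m\,\frac{P(dx)}{d}\Bigr)\Bigr|\le X^{1-\tau}$$ for all positive integers $d$, all real $X\ge X_0$ and all positive integers $m<X^{\rho}$, where $x$ runs over the integers in $[1,X]$. -/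

import Mathlib

/-- `α` is Liouville: for every natural number `n` there are integers `p`, `q` with `q > 1` and
`|α - p / q| ≤ q ^ (-n)`. Equality `α = p / q` is allowed, so every rational number is Liouville
in this sense (unlike for Mathlib's `Liouville`). -/
def IsLiouvilleNumber (α : ℝ) : Prop :=
  ∀ n : ℕ, ∃ p q : ℤ, 1 < q ∧ |α - (p : ℝ) / (q : ℝ)| ≤ (q : ℝ) ^ (-(n : ℤ))

/-- The additive character `e(t) = exp(2 π i t)`. -/
noncomputable def expChar (t : ℝ) : ℂ :=
  Complex.exp (2 * (Real.pi : ℂ) * Complex.I * (t : ℂ))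

/-- The Weyl sum of `m P(d x) / d` over the positive integers `x ≤ X`. -/
noncomputable def weylSum (P : Polynomial ℝ) (d m : ℕ) (X : ℝ) : ℂ :=
  ∑ x ∈ Finset.Icc 1 ⌊X⌋₊, expChar ((m : ℝ) * (P.eval ((d : ℝ) * (x : ℝ)) / (d : ℝ)))

/-! Put `f(x) = m P(dx) / d`. Its linear coefficient is `m α`, with `α` that of `P`, whatever `d`
is; this is why the bound is uniform in `d`. The other coefficients may be arbitrary.

The engine is an inverse form of Weyl's inequality (`UpperCoeffBound`): if a sum of length `N` over
a polynomial of degree at most `k` is at least `N / K`, then one `q ≤ K ^ C` brings every `q f_i`,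
`i ≥ 1`, within `K ^ C / N ^ i` of an integer, with `C` depending only on `k`. For `i = 1` this
makes `q m α` nearly integral with `q m` at most a power of `K`, which a non-Liouville `α` forbids
once `K` is a small power of `X`.

For the leading coefficient, differencing lowers the degree by one, so induction makes `t γ` nearly
integral for many shifts `t`, where `γ` is a multiple of that coefficient;
`exists_distInt_mul_le_of_recurrent` turns this recurrence into one very good approximation. Lower
coefficients follow by descent: on a short progression whose difference is the common denominator
found so far, the higher terms are negligible modulo one and the next coefficient leads. -/

open Finset Polynomial

/-! ### Distance to the nearest integer and additive characters -/

/-- The distance from a real number to the nearest integer. -/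
noncomputable def distInt (x : ℝ) : ℝ := ‖(x : UnitAddCircle)‖

theorem distInt_eq (x : ℝ) : distInt x = |x - round x| := UnitAddCircle.norm_eq

theorem distInt_nonneg (x : ℝ) : 0 ≤ distInt x := norm_nonneg _

theorem distInt_le_half (x : ℝ) : distInt x ≤ 1 / 2 := by
  rw [distInt_eq]; exact abs_sub_round x

theorem distInt_le_abs_sub_intCast (x : ℝ) (n : ℤ) : distInt x ≤ |x - n| := by
  rw [distInt_eq]; exact round_le x n

theorem distInt_zero : distInt 0 = 0 := by simp [distInt]

theorem distInt_add_le (x y : ℝ) : distInt (x + y) ≤ distInt x + distInt y := by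
  simpa [distInt] using norm_add_le (x : UnitAddCircle) (y : UnitAddCircle)

theorem distInt_sub_le (x y : ℝ) : distInt (x - y) ≤ distInt x + distInt y := by
  simpa [distInt] using norm_sub_le (x : UnitAddCircle) (y : UnitAddCircle)

theorem distInt_sum_le {ι : Type*} (s : Finset ι) (f : ι → ℝ) :
    distInt (∑ i ∈ s, f i) ≤ ∑ i ∈ s, distInt (f i) := by
  classical
  induction s using Finset.induction_on with
  | empty => simp [distInt_zero]
  | insert a s ha ih =>
    rw [sum_insert ha, sum_insert ha]
    exact (distInt_add_le _ _).trans (by gcongr)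

theorem distInt_natCast_mul_le (n : ℕ) (x : ℝ) : distInt (n * x) ≤ n * distInt x := by
  have h := distInt_le_abs_sub_intCast (n * x) (n * round x)
  rwa [Int.cast_mul, Int.cast_natCast, ← mul_sub, abs_mul, Nat.abs_cast, ← distInt_eq] at h

theorem distInt_sub_intCast (x : ℝ) (n : ℤ) : distInt (x - n) = distInt x := by
  simp [distInt_eq]

theorem distInt_eq_abs {x : ℝ} (hx : |x| ≤ 1 / 2) : distInt x = |x| :=
  (AddCircle.norm_coe_eq_abs_iff (1 : ℝ) one_ne_zero).2 (by simpa using hx)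

theorem expChar_add (a b : ℝ) : expChar (a + b) = expChar a * expChar b := by
  simp [expChar, mul_add, Complex.exp_add]

theorem expChar_eq (a : ℝ) : expChar a = Complex.exp (Complex.I * (2 * Real.pi * a : ℝ)) := by
  simp only [expChar]; congr 1; push_cast; ring

theorem norm_expChar (a : ℝ) : ‖expChar a‖ = 1 := by
  rw [expChar_eq, mul_comm]; exact Complex.norm_exp_ofReal_mul_I _

theorem expChar_intCast (n : ℤ) : expChar n = 1 := by
  rw [expChar, Complex.exp_eq_one_iff]; exact ⟨n, by push_cast; ring⟩

theorem expChar_sub_round (a : ℝ) : expChar (a - round a) = expChar a := by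
  have := expChar_add (a - round a) (round a : ℤ)
  rw [expChar_intCast] at this
  simpa using this.symm

theorem conj_expChar (a : ℝ) : (starRingEnd ℂ) (expChar a) = expChar (-a) := by
  rw [expChar_eq, expChar_eq, ← Complex.exp_conj]
  congr 1
  simp [map_mul, Complex.conj_ofReal, Complex.conj_ofNat]

theorem norm_expChar_sub_one_le (a : ℝ) : ‖expChar a - 1‖ ≤ 2 * Real.pi * distInt a := by
  rw [← expChar_sub_round, expChar_eq, distInt_eq]
  refine Real.norm_exp_I_mul_ofReal_sub_one_le.trans_eq ?_
  rw [Real.norm_eq_abs, abs_mul, abs_of_pos Real.two_pi_pos]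

theorem norm_expChar_sub_le (a b : ℝ) :
    ‖expChar a - expChar b‖ ≤ 2 * Real.pi * distInt (a - b) := by
  have h : expChar a - expChar b = expChar b * (expChar (a - b) - 1) := by
    rw [mul_sub, ← expChar_add, add_sub_cancel, mul_one]
  rw [h, norm_mul, norm_expChar, one_mul]
  exact norm_expChar_sub_one_le _

theorem four_mul_distInt_le (a : ℝ) : 4 * distInt a ≤ ‖expChar a - 1‖ := by
  rw [← expChar_sub_round, expChar_eq, distInt_eq, Complex.norm_exp_I_mul_ofReal_sub_one]
  have h := abs_sub_round a
  set x := a - round a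
  have h2 := Real.mul_abs_le_abs_sin (x := 2 * Real.pi * x / 2) (by
    rw [show 2 * Real.pi * x / 2 = Real.pi * x by ring, abs_mul, abs_of_pos Real.pi_pos]
    nlinarith [Real.pi_pos])
  rw [norm_mul, Real.norm_eq_abs, Real.norm_eq_abs, abs_of_pos (by norm_num : (0 : ℝ) < 2)]
  refine le_trans (le_of_eq ?_) (mul_le_mul_of_nonneg_left h2 zero_le_two)
  rw [show 2 * Real.pi * x / 2 = Real.pi * x by ring, abs_mul, abs_of_pos Real.pi_pos]
  field_simp
  ring

/-- Geometric sums of additive characters. -/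
theorem distInt_mul_norm_sum_linear_le (a b : ℝ) (H : ℕ) :
    2 * distInt a * ‖∑ h ∈ range H, expChar (b + a * h)‖ ≤ 1 := by
  have hs : ∀ h : ℕ, expChar (b + a * h) = expChar b * expChar a ^ h := by
    intro h
    induction h with
    | zero => simp
    | succ h ih => rw [pow_succ, ← mul_assoc, ← ih, ← expChar_add]; push_cast; ring_nf
  simp_rw [hs]
  rw [← mul_sum, norm_mul, norm_expChar, one_mul]
  have h1 := four_mul_distInt_le a
  have h2 : ‖∑ h ∈ range H, expChar a ^ h‖ * ‖expChar a - 1‖ ≤ 2 := by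
    rw [← norm_mul, geom_sum_mul]
    refine (norm_sub_le _ _).trans ?_
    simp [norm_expChar]; norm_num
  nlinarith [norm_nonneg (∑ h ∈ range H, expChar a ^ h)]

/-! ### Weyl differencing -/

theorem sum_range_sum_range_eq_sum_shift {M : Type*} [AddCommMonoid M] (F : ℕ → ℕ → M) (H : ℕ) :
    ∑ a ∈ range H, ∑ b ∈ range a, F a b =
      ∑ t ∈ Ico 1 H, ∑ h ∈ range (H - t), F (h + t) h := by
  rw [sum_sigma', sum_sigma']
  refine sum_nbij' (fun x => ⟨x.1 - x.2, x.2⟩) (fun x => ⟨x.2 + x.1, x.2⟩) ?_ ?_ ?_ ?_ ?_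
  · rintro ⟨a, b⟩ h; simp at h ⊢; omega
  · rintro ⟨a, b⟩ h; simp at h ⊢; omega
  · rintro ⟨a, b⟩ h; simp at h ⊢; omega
  · rintro ⟨a, b⟩ h; simp at h ⊢
  · rintro ⟨a, b⟩ h; simp at h ⊢; rw [Nat.add_sub_cancel' h.2.le]

/-- Expanding the square gives `H` from the diagonal and twice the real part of the terms below it,
which are grouped by the difference `t` of the indices. -/
theorem norm_sq_sum_range_le (u : ℕ → ℂ) (hu : ∀ n, ‖u n‖ = 1) (H : ℕ) :
    ‖∑ h ∈ range H, u h‖ ^ 2 ≤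
      H + 2 * ∑ t ∈ Ico 1 H, ‖∑ h ∈ range (H - t), u (h + t) * (starRingEnd ℂ) (u h)‖ := by
  have key : ∀ H : ℕ, ‖∑ h ∈ range H, u h‖ ^ 2 =
      H + 2 * (∑ a ∈ range H, ∑ b ∈ range a, u a * (starRingEnd ℂ) (u b)).re := by
    intro H
    induction H with
    | zero => simp
    | succ H ih =>
      rw [sum_range_succ, sum_range_succ _ H, ← Complex.normSq_eq_norm_sq, Complex.normSq_add,
        Complex.normSq_eq_norm_sq, Complex.normSq_eq_norm_sq, ih, hu, ← mul_sum, ← map_sum,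
        Complex.add_re]
      push_cast
      simp only [Complex.mul_re, Complex.conj_re, Complex.conj_im]
      ring
  rw [key, sum_range_sum_range_eq_sum_shift]
  gcongr
  exact (Complex.re_le_norm _).trans (norm_sum_le _ _)

theorem distInt_sub_mul_le {γ ε : ℝ} {s t : ℕ} (hst : s ≤ t) (hs : distInt (s * γ) ≤ ε)
    (ht : distInt (t * γ) ≤ ε) : distInt ((t - s : ℕ) * γ) ≤ 2 * ε := by
  rw [Nat.cast_sub hst, sub_mul]
  linarith [distInt_sub_le (t * γ) (s * γ)]

/-! ### Recurrence implies rational approximation -/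

/-- Two elements of a dense set of integers are close to each other. -/
theorem exists_lt_sub_lt_of_dense {M : ℝ} (hM : 1 ≤ M) {N : ℕ} (hN : 2 * M < N) {T : Finset ℕ}
    (hT : T ⊆ range N) (hcard : (N : ℝ) ≤ #T * M) :
    ∃ s ∈ T, ∃ t ∈ T, s < t ∧ ((t - s : ℕ) : ℝ) ≤ 3 * M := by
  -- Pigeonhole on blocks of length about `2 * M`: there are fewer blocks than elements of `T`.
  set G := ⌈2 * M⌉₊
  have hG : 2 * M ≤ G := Nat.le_ceil _
  have hG' : (G : ℝ) < 2 * M + 1 := Nat.ceil_lt_add_one (by linarith)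
  have hG0 : 0 < G := by
    rw [← Nat.cast_pos (α := ℝ)]; linarith
  have hlt : #(range (N / G + 1)) < #T := by
    rw [card_range, ← Nat.cast_lt (α := ℝ)]
    push_cast
    have h1 : ((N / G : ℕ) : ℝ) ≤ N / G := Nat.cast_div_le
    have h2 : (N : ℝ) / G ≤ N / (2 * M) := by gcongr
    have h3 : (N : ℝ) / M ≤ #T := by rwa [div_le_iff₀ (by linarith)]
    have h4 : (1 : ℝ) < N / (2 * M) := by rwa [one_lt_div (by linarith)]
    have h5 : (N : ℝ) / M = N / (2 * M) + N / (2 * M) := by field_simp; ring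
    linarith
  obtain ⟨s, hs, t, ht, hne, heq⟩ := exists_ne_map_eq_of_card_lt_of_maps_to hlt
    (f := fun t => t / G) (fun t ht => by
      have := mem_range.1 (hT ht)
      exact mem_coe.2 (mem_range.2 (Nat.lt_succ_of_le (Nat.div_le_div_right this.le))))
  have hclose : ∀ s t : ℕ, s / G = t / G → s < t → ((t - s : ℕ) : ℝ) ≤ 3 * M := by
    intro s t h hst
    have h1 := Nat.div_add_mod s G
    have h2 := Nat.div_add_mod t G
    have h3 := Nat.mod_lt t hG0
    rw [h] at h1
    have h4 : t - s < G := by omega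
    have h5 : t - s + 1 ≤ G := h4
    have h6 : ((t - s : ℕ) : ℝ) + 1 ≤ G := by exact_mod_cast h5
    linarith
  rcases lt_or_gt_of_ne hne with h | h
  · exact ⟨s, hs, t, ht, h, hclose _ _ heq h⟩
  · exact ⟨t, ht, s, hs, h, hclose _ _ heq.symm h⟩

/-- A dense set of integers has two elements which are congruent modulo `q`, at distance less
than `L`, and yet far apart. -/
theorem exists_modEq_sub_lt_of_dense {M : ℝ} (hM : 1 ≤ M) {N q L : ℕ} (hq : 0 < q) (hL : 0 < L)
    (hqM : (q : ℝ) ≤ 3 * M) (hLN : (N : ℝ) ≤ 32 * M * L) (hN : 198 * M ^ 3 ≤ N) {T : Finset ℕ}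
    (hT : T ⊆ range N) (hcard : (N : ℝ) ≤ #T * M) :
    ∃ s ∈ T, ∃ t ∈ T, s < t ∧ q ∣ t - s ∧ t - s < L ∧ (N : ℝ) ≤ 198 * M ^ 3 * (t - s : ℕ) := by
  -- Classes are pairs (residue modulo `q`, block of length `L`), at most `3 * M * (33 * M)` in
  -- number. The two extreme elements of a large class are the ones wanted.
  set W := range q ×ˢ range (N / L + 1)
  have hmaps : ∀ t ∈ T, (t % q, t / L) ∈ W := by
    intro t ht
    have := mem_range.1 (hT ht)
    exact mem_product.2 ⟨mem_range.2 (Nat.mod_lt _ hq),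
      mem_range.2 (Nat.lt_succ_of_le (Nat.div_le_div_right this.le))⟩
  have hWcard : (#W : ℝ) ≤ 99 * M ^ 2 := by
    rw [card_product, card_range, card_range]
    push_cast
    have h1 : ((N / L : ℕ) : ℝ) ≤ N / L := Nat.cast_div_le
    have h2 : (N : ℝ) / L ≤ 32 * M := by rwa [div_le_iff₀ (by exact_mod_cast hL)]
    calc (q : ℝ) * (((N / L : ℕ) : ℝ) + 1) ≤ 3 * M * (33 * M) := by gcongr; linarith
      _ = _ := by ring
  have hN0 : (0 : ℝ) < N := lt_of_lt_of_le (by positivity) hN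
  obtain ⟨w, hw, hfib⟩ := exists_le_card_fiber_of_nsmul_le_card_of_maps_to (M := ℝ) hmaps
    (b := (N : ℝ) / (99 * M ^ 3)) ⟨(0, 0), by simp [W, hq]⟩ (by
      rw [nsmul_eq_mul]
      calc (#W : ℝ) * (N / (99 * M ^ 3)) ≤ 99 * M ^ 2 * (N / (99 * M ^ 3)) := by gcongr
        _ = N / M := by field_simp
        _ ≤ #T := by rwa [div_le_iff₀ (by linarith)])
  set F := {x ∈ T | (x % q, x / L) = w}
  have hF2 : (2 : ℝ) ≤ N / (99 * M ^ 3) := by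
    rw [le_div_iff₀ (by positivity)]; linarith
  have hne : F.Nonempty := by
    rw [← card_pos, ← Nat.cast_pos (α := ℝ)]; linarith
  have hmin := F.min'_mem hne
  have hmax := F.max'_mem hne
  set s := F.min' hne
  set t := F.max' hne
  have hst : s ≤ t := F.min'_le_max' hne
  have hsub : F ⊆ Icc s t := fun x hx => mem_Icc.2 ⟨F.min'_le x hx, F.le_max' x hx⟩
  have hc := card_le_card hsub
  rw [Nat.card_Icc] at hc
  have hc' : (#F : ℝ) ≤ (t - s : ℕ) + 1 := by
    have : #F ≤ (t - s) + 1 := by omega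
    exact_mod_cast this
  -- The class has at most `t - s + 1` elements and at least `N / (99 * M ^ 3) ≥ 2`, so dropping the
  -- `1` costs at most a factor two.
  have hd : (N : ℝ) / (198 * M ^ 3) ≤ (t - s : ℕ) := by
    have : (N : ℝ) / (99 * M ^ 3) = 2 * (N / (198 * M ^ 3)) := by field_simp; norm_num
    linarith
  have hpos : 0 < t - s := by
    rw [← Nat.cast_pos (α := ℝ)]
    exact lt_of_lt_of_le (by positivity) hd
  obtain ⟨hsT, hsw⟩ := mem_filter.1 hmin
  obtain ⟨htT, htw⟩ := mem_filter.1 hmax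
  have hsw' := hsw.trans htw.symm
  simp only [Prod.mk.injEq] at hsw'
  refine ⟨s, hsT, t, htT, by omega, (Nat.modEq_iff_dvd' hst).1 hsw'.1, ?_, ?_⟩
  · have h1 := Nat.div_add_mod s L
    have h2 := Nat.div_add_mod t L
    have h3 := Nat.mod_lt t hL
    rw [hsw'.2] at h1
    omega
  · rwa [div_le_iff₀ (by positivity), mul_comm] at hd

/-- A real number which is often close to being a root of unity has a small multiple very close to
an integer. -/
theorem exists_distInt_mul_le_of_recurrent {M ε γ : ℝ} (hM : 1 ≤ M) {N : ℕ}
    (hN : 198 * M ^ 3 ≤ N) (hε : ε * N ≤ M) {T : Finset ℕ} (hT : T ⊆ range N)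
    (hcard : (N : ℝ) ≤ #T * M) (hrec : ∀ t ∈ T, distInt (t * γ) ≤ ε) :
    ∃ q : ℕ, 1 ≤ q ∧ (q : ℝ) ≤ 3 * M ∧ distInt (q * γ) * N ≤ 1188 * M ^ 4 * ε := by
  have hM3 : M ≤ M ^ 3 := le_self_pow₀ hM (by norm_num)
  obtain ⟨s, hs, t, ht, hst, hq⟩ := exists_lt_sub_lt_of_dense hM (by linarith) hT hcard
  have hε0 : 0 ≤ ε := (distInt_nonneg _).trans (hrec s hs)
  have hqd := distInt_sub_mul_le hst.le (hrec s hs) (hrec t ht)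
  have hq1 : 1 ≤ t - s := by omega
  generalize t - s = q at hq hqd hq1
  clear hs ht hst s t
  refine ⟨q, hq1, hq, ?_⟩
  -- Chosen so that `L * ε ≤ 1 / 16`: multiples `k * θ` with `k ≤ L` then cannot wrap around modulo
  -- one.
  set L := ⌊(N : ℝ) / (16 * M)⌋₊
  have hLle : (L : ℝ) ≤ N / (16 * M) := Nat.floor_le (by positivity)
  have hone : 1 ≤ (N : ℝ) / (16 * M) := by rw [le_div_iff₀ (by positivity)]; linarith
  have hL1 : 1 ≤ L := Nat.le_floor (by simpa using hone)
  have hLge : (N : ℝ) ≤ 32 * M * L := by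
    have h1 : (N : ℝ) / (16 * M) < L + 1 := Nat.lt_floor_add_one _
    have h2 : (1 : ℝ) ≤ L := by exact_mod_cast hL1
    have h3 : (N : ℝ) / (16 * M) ≤ 2 * L := by linarith
    rw [div_le_iff₀ (by positivity)] at h3
    linarith
  obtain ⟨s, hs, t, ht, hst, ⟨k, hk⟩, hlt, hfar⟩ :=
    exists_modEq_sub_lt_of_dense hM hq1 hL1 hq hLge hN hT hcard
  have hd := distInt_sub_mul_le hst.le (hrec s hs) (hrec t ht)
  rw [hk] at hd hlt hfar
  rw [distInt_eq] at hqd ⊢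
  set θ := (q : ℝ) * γ - round (q * γ)
  have hqr : (1 : ℝ) ≤ q := by exact_mod_cast hq1
  have hkL : (k : ℝ) ≤ L := by
    have : k ≤ q * k := Nat.le_mul_of_pos_left k hq1
    exact_mod_cast this.trans hlt.le
  have hLε : L * ε ≤ 1 / 16 := by
    calc L * ε ≤ N / (16 * M) * ε := by gcongr
      _ = (ε * N) / (16 * M) := by ring
      _ ≤ M / (16 * M) := by gcongr
      _ = 1 / 16 := by field_simp
  have hkθ : |k * θ| ≤ 1 / 2 := by
    rw [abs_mul, Nat.abs_cast]
    calc k * |θ| ≤ L * (2 * ε) := by gcongr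
      _ ≤ 1 / 2 := by linarith
  -- Without wrap-around the distance of `q * k * γ` to the integers is exactly `k * |θ|`; as `q *
  -- k` is comparable to `N`, dividing by `k` gains the factor `N`.
  have hkθ2 : k * |θ| ≤ 2 * ε := by
    have h1 : ((q * k : ℕ) : ℝ) * γ = k * θ + (k * round (q * γ) : ℤ) := by
      simp only [θ]; push_cast; ring
    have h2 := distInt_sub_intCast (((q * k : ℕ) : ℝ) * γ) (k * round (q * γ))
    rw [← h2, h1, add_sub_cancel_right, distInt_eq_abs hkθ, abs_mul, Nat.abs_cast] at hd
    exact hd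
  calc |θ| * N ≤ |θ| * (198 * M ^ 3 * (q * k : ℕ)) := by gcongr
    _ = 198 * M ^ 3 * q * (k * |θ|) := by push_cast; ring
    _ ≤ 198 * M ^ 3 * (3 * M) * (2 * ε) := by gcongr
    _ = _ := by ring

/-! ### The leading coefficient -/

/-- If an exponential sum over a polynomial of degree at most `j` is within a factor `K` of being
trivially large, then the coefficient of degree `j` is well approximated by a rational number whose
denominator is at most a power of `K`. -/
def LeadingCoeffBound (j C : ℕ) : Prop :=
  ∀ K : ℝ, 2 ≤ K → ∀ H : ℕ, 1 ≤ H → ∀ g : ℝ[X], g.natDegree ≤ j →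
    (H : ℝ) ≤ K * ‖∑ h ∈ range H, expChar (g.eval (h : ℝ))‖ →
    ∃ q : ℕ, 1 ≤ q ∧ (q : ℝ) ≤ K ^ C ∧ distInt (q * g.coeff j) * (H : ℝ) ^ j ≤ K ^ C

theorem leadingCoeffBound_one : LeadingCoeffBound 1 1 := by
  intro K hK H hH g hg hS
  refine ⟨1, le_rfl, by simp; linarith, ?_⟩
  have hev : ∀ h : ℕ, g.eval (h : ℝ) = g.coeff 0 + g.coeff 1 * h := by
    intro h
    rw [eval_eq_sum_range' (Nat.lt_succ_of_le hg)]
    simp [sum_range_succ]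
  simp_rw [hev] at hS
  have h1 := distInt_mul_norm_sum_linear_le (g.coeff 1) (g.coeff 0) H
  set S := ‖∑ h ∈ range H, expChar (g.coeff 0 + g.coeff 1 * h)‖
  have h0 := distInt_nonneg (g.coeff 1)
  simp only [Nat.cast_one, one_mul, pow_one]
  calc distInt (g.coeff 1) * H ≤ distInt (g.coeff 1) * (K * S) := by gcongr
    _ = K / 2 * (2 * distInt (g.coeff 1) * S) := by ring
    _ ≤ K / 2 * 1 := by gcongr
    _ ≤ K := by linarith

/-- The linear dependence on the shift `t` is what lets the recurrence lemma apply to the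
differenced polynomials. -/
theorem coeff_taylor_sub {j : ℕ} {g : ℝ[X]} (hg : g.natDegree ≤ j + 1) (t : ℝ) :
    (taylor t g - g).coeff j = (j + 1) * t * g.coeff (j + 1) := by
  have hd : (hasseDeriv j g).natDegree < 2 := by
    have := natDegree_hasseDeriv_le g j
    omega
  rw [coeff_sub, taylor_coeff, eval_eq_sum_range' hd]
  simp [sum_range_succ, hasseDeriv_coeff, add_comm 1 j]
  ring

theorem natDegree_taylor_sub_le {j : ℕ} {g : ℝ[X]} (hg : g.natDegree ≤ j + 1) (t : ℝ) :
    (taylor t g - g).natDegree ≤ j := by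
  rw [natDegree_le_iff_coeff_eq_zero]
  intro N hN
  have hle : (taylor t g - g).natDegree ≤ j + 1 :=
    (natDegree_sub_le _ _).trans (by rw [natDegree_taylor]; simpa using hg)
  rcases (Nat.succ_le_of_lt hN).eq_or_lt with h | h
  · rw [← h, coeff_sub, taylor_coeff]
    have hd : (hasseDeriv (j + 1) g).natDegree < 1 := by
      have := natDegree_hasseDeriv_le g (j + 1)
      omega
    rw [Nat.succ_eq_add_one, eval_eq_sum_range' hd]
    simp [hasseDeriv_coeff]
  · exact coeff_eq_zero_of_natDegree_lt (hle.trans_lt h)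

/-- If an exponential sum is large, then so are many of the sums obtained by differencing. -/
theorem exists_dense_large_differences {K : ℝ} (hK : 2 ≤ K) {H : ℕ} (hH : 2 * K ^ 2 ≤ H)
    (g : ℝ[X]) (hS : (H : ℝ) ≤ K * ‖∑ h ∈ range H, expChar (g.eval (h : ℝ))‖) :
    ∃ T ⊆ Ico 1 H, (H : ℝ) ≤ K ^ 5 * #T ∧ ∀ t ∈ T, (H : ℝ) ≤
      K ^ 5 * ‖∑ h ∈ range (H - t), expChar ((taylor (t : ℝ) g - g).eval (h : ℝ))‖ := by
  have hK0 : 0 < K := by linarith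
  have h8 : 8 * K ^ 2 ≤ K ^ 5 := by
    calc 8 * K ^ 2 = 2 ^ 3 * K ^ 2 := by norm_num
      _ ≤ K ^ 3 * K ^ 2 := by gcongr
      _ = _ := by ring
  set D : ℕ → ℝ := fun t =>
    ‖∑ h ∈ range (H - t), expChar ((taylor (t : ℝ) g - g).eval (h : ℝ))‖ with hD
  have hdiff := norm_sq_sum_range_le (fun h => expChar (g.eval (h : ℝ)))
    (fun _ => norm_expChar _) H
  have hDeq : ∀ t, ‖∑ h ∈ range (H - t), expChar (g.eval ((h + t : ℕ) : ℝ)) *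
      (starRingEnd ℂ) (expChar (g.eval (h : ℝ)))‖ = D t := by
    intro t
    simp only [hD, eval_sub, taylor_eval]
    simp only [conj_expChar, ← expChar_add, Nat.cast_add, sub_eq_add_neg]
  simp only [hDeq] at hdiff
  set S := ‖∑ h ∈ range H, expChar (g.eval (h : ℝ))‖
  have hHr : (0 : ℝ) < H := lt_of_lt_of_le (by positivity) hH
  have hsq : (H : ℝ) ^ 2 ≤ K ^ 2 * S ^ 2 := by
    rw [← mul_pow]; gcongr
  -- Since `2 * K ^ 2 ≤ H`, the diagonal term is at most half of the left side.
  have hsum : (H : ℝ) ^ 2 ≤ 4 * K ^ 2 * ∑ t ∈ Ico 1 H, D t := by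
    have h1 : K ^ 2 * S ^ 2 ≤ K ^ 2 * (H + 2 * ∑ t ∈ Ico 1 H, D t) := by gcongr
    have h2 : 2 * K ^ 2 * H ≤ H * H := by gcongr
    nlinarith
  -- With this threshold the discarded shifts account for at most half of `hsum`.
  refine ⟨{t ∈ Ico 1 H | (H : ℝ) ≤ 8 * K ^ 2 * D t}, filter_subset _ _, ?_, ?_⟩
  · have hsplit := sum_filter_add_sum_filter_not (Ico 1 H) (fun t => (H : ℝ) ≤ 8 * K ^ 2 * D t) D
    set T := {t ∈ Ico 1 H | (H : ℝ) ≤ 8 * K ^ 2 * D t}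
    have hDle : ∀ t, D t ≤ H := by
      intro t
      refine (norm_sum_le _ _).trans ?_
      simp only [norm_expChar, sum_const, card_range, nsmul_eq_mul, mul_one]
      exact_mod_cast Nat.sub_le H t
    have h1 : ∑ t ∈ T, D t ≤ #T * H := by
      rw [← nsmul_eq_mul]
      exact sum_le_card_nsmul _ _ _ fun t _ => hDle t
    have h2 : ∑ t ∈ Ico 1 H with ¬ (H : ℝ) ≤ 8 * K ^ 2 * D t, D t ≤ H * (H / (8 * K ^ 2)) := by
      refine (sum_le_card_nsmul _ _ (H / (8 * K ^ 2)) fun t ht => ?_).trans ?_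
      · rw [le_div_iff₀ (by positivity)]
        linarith [(mem_filter.1 ht).2]
      · rw [nsmul_eq_mul]
        gcongr
        refine (card_filter_le _ _).trans ?_
        simp
    have h3 : (H : ℝ) ^ 2 ≤ 4 * K ^ 2 * (#T * H + H * (H / (8 * K ^ 2))) := by
      refine hsum.trans ?_
      gcongr
      linarith
    have h4 : 4 * K ^ 2 * (#T * H + H * (H / (8 * K ^ 2))) =
        4 * K ^ 2 * #T * H + H ^ 2 / 2 := by field_simp; ring
    rw [h4] at h3
    have h5 : (H : ℝ) ≤ 8 * K ^ 2 * #T := by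
      refine le_of_mul_le_mul_right ?_ hHr
      nlinarith
    exact h5.trans (by gcongr)
  · intro t ht
    exact (mem_filter.1 ht).2.trans (mul_le_mul_of_nonneg_right h8 (norm_nonneg _))

theorem exists_dense_fiber {T : Finset ℕ} (f : ℕ → ℕ) {B : ℝ} (hB : 1 ≤ B)
    (hf : ∀ t ∈ T, 1 ≤ f t ∧ (f t : ℝ) ≤ B) :
    ∃ q : ℕ, 1 ≤ q ∧ (q : ℝ) ≤ B ∧ (#T : ℝ) ≤ B * #{t ∈ T | f t = q} := by
  have hfl : (⌊B⌋₊ : ℝ) ≤ B := Nat.floor_le (by linarith)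
  have h1 : 1 ≤ ⌊B⌋₊ := Nat.le_floor (by simpa using hB)
  obtain ⟨q, hq, hc⟩ := exists_le_card_fiber_of_nsmul_le_card_of_maps_to (M := ℝ)
    (s := T) (t := Icc 1 ⌊B⌋₊) (f := f) (b := #T / B)
    (fun t ht => mem_Icc.2 ⟨(hf t ht).1, Nat.le_floor (hf t ht).2⟩) (by simpa using h1) (by
      rw [nsmul_eq_mul, Nat.card_Icc, Nat.add_sub_cancel]
      calc (⌊B⌋₊ : ℝ) * (#T / B) ≤ B * (#T / B) := by gcongr
        _ = #T := by field_simp)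
  rw [mem_Icc] at hq
  refine ⟨q, hq.1, (Nat.cast_le.2 hq.2).trans hfl, ?_⟩
  rwa [div_le_iff₀' (by linarith)] at hc

theorem natCast_succ_le_pow {K : ℝ} (hK : 2 ≤ K) (j : ℕ) : (j : ℝ) + 1 ≤ K ^ j := by
  have h : j + 1 ≤ 2 ^ j := Nat.lt_two_pow_self
  calc (j : ℝ) + 1 ≤ 2 ^ j := by exact_mod_cast h
    _ ≤ K ^ j := by gcongr

/-- Apply the bound in degree `j` to the differenced polynomials, make their denominators equal by
pigeonhole, and feed the surviving shifts to the recurrence lemma. -/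
theorem LeadingCoeffBound.succ {j C : ℕ} (hj : 1 ≤ j) (hC : LeadingCoeffBound j C) :
    ∃ C', LeadingCoeffBound (j + 1) C' := by
  -- Differencing replaces `K` by `K ^ 5`: `5 * C` is the inductive loss, `5 * j` that of replacing
  -- `H - t` by `H`. `E` ensures `198 * (K ^ A) ^ 3 ≤ H`; shorter sums are trivial with `q = 1`.
  set A := 5 * C + 5 * j
  set E := 3 * A + 8
  refine ⟨E * (j + 1) + (5 * A + 11) + (5 * C + j), ?_⟩
  intro K hK H hH g hg hS
  have hK1 : 1 ≤ K := by linarith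
  have hpow : ∀ {a b : ℕ}, a ≤ b → K ^ a ≤ K ^ b := fun h => pow_le_pow_right₀ hK1 h
  have hnum : ∀ {a : ℝ} (n : ℕ), a ≤ 2 ^ n → a ≤ K ^ n := fun n h =>
    h.trans (by gcongr)
  rcases lt_or_ge (H : ℝ) (K ^ E) with hsmall | hbig
  · refine ⟨1, le_rfl, by simpa using one_le_pow₀ hK1, ?_⟩
    calc distInt ((1 : ℕ) * g.coeff (j + 1)) * (H : ℝ) ^ (j + 1)
        ≤ 1 * (K ^ E) ^ (j + 1) := by
          gcongr
          exact (distInt_le_half _).trans (by norm_num)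
      _ = K ^ (E * (j + 1)) := by rw [one_mul, pow_mul]
      _ ≤ _ := hpow (by omega)
  have hH0 : (0 : ℝ) < H := by exact_mod_cast hH
  obtain ⟨T, hTsub, hTcard, hTlarge⟩ := exists_dense_large_differences hK (H := H) (by
    calc 2 * K ^ 2 ≤ K * K ^ 2 := by gcongr
      _ = K ^ 3 := by ring
      _ ≤ K ^ E := hpow (by omega)
      _ ≤ H := hbig) g hS
  have hex : ∀ t ∈ T, ∃ q : ℕ, (1 ≤ q ∧ (q : ℝ) ≤ K ^ (5 * C)) ∧
      distInt (q * ((j + 1) * t * g.coeff (j + 1))) ≤ K ^ A / (H : ℝ) ^ j := by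
    intro t ht
    have hlt := mem_Ico.1 (hTsub ht)
    have hlarge := hTlarge t ht
    obtain ⟨q, hq1, hq2, hq3⟩ := hC (K ^ 5) (hnum 5 (by norm_num)) (H - t) (by omega)
      (taylor (t : ℝ) g - g) (natDegree_taylor_sub_le hg _)
      (le_trans (by exact_mod_cast Nat.sub_le H t) hlarge)
    rw [coeff_taylor_sub hg] at hq3
    rw [← pow_mul] at hq2 hq3
    refine ⟨q, ⟨hq1, hq2⟩, ?_⟩
    -- A large sum of `H - t` unimodular terms must have many terms.
    have hlen : (H : ℝ) ≤ K ^ 5 * (H - t : ℕ) := by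
      refine hlarge.trans ?_
      gcongr
      refine (norm_sum_le _ _).trans ?_
      simp [norm_expChar]
    rw [le_div_iff₀ (by positivity)]
    have hd0 := distInt_nonneg (q * ((j + 1) * t * g.coeff (j + 1)))
    calc _ ≤ distInt (q * ((j + 1) * t * g.coeff (j + 1))) * (K ^ 5 * (H - t : ℕ)) ^ j := by
          gcongr
      _ = (distInt (q * ((j + 1) * t * g.coeff (j + 1))) * ((H - t : ℕ) : ℝ) ^ j) * K ^ (5 * j) := by
          rw [mul_pow, ← pow_mul]; ring
      _ ≤ K ^ (5 * C) * K ^ (5 * j) := by gcongr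
      _ = K ^ A := by rw [← pow_add]
  choose! f hf1 hf2 using hex
  obtain ⟨q, hq1, hq2, hqcard⟩ := exists_dense_fiber f (one_le_pow₀ hK1) hf1
  set T' := {t ∈ T | f t = q}
  set ε := K ^ A / (H : ℝ) ^ j
  have hT'card : (H : ℝ) ≤ #T' * K ^ A := by
    calc (H : ℝ) ≤ K ^ 5 * (K ^ (5 * C) * #T') := hTcard.trans (by gcongr)
      _ = #T' * K ^ (5 + 5 * C) := by rw [pow_add]; ring
      _ ≤ #T' * K ^ A := by
        gcongr
        omega
  have hεH : ε * H ≤ K ^ A := by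
    rw [div_mul_eq_mul_div, div_le_iff₀ (by positivity)]
    gcongr
    exact le_self_pow₀ (by exact_mod_cast hH) (by omega)
  obtain ⟨r, hr1, hr2, hr3⟩ := exists_distInt_mul_le_of_recurrent
    (γ := q * ((j + 1) * g.coeff (j + 1))) (T := T') (one_le_pow₀ hK1) (by
      calc 198 * (K ^ A) ^ 3 ≤ K ^ 8 * (K ^ A) ^ 3 := by gcongr; exact hnum 8 (by norm_num)
        _ = K ^ E := by rw [← pow_mul, ← pow_add]; congr 1; omega
        _ ≤ H := hbig) hεH (by
      intro t ht
      exact mem_range.2 (mem_Ico.1 (hTsub (mem_filter.1 ht).1)).2) hT'card (by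
      intro t ht
      obtain ⟨htT, rfl⟩ := mem_filter.1 ht
      convert hf2 t htT using 2
      ring)
  refine ⟨r * q * (j + 1), Nat.mul_pos (Nat.mul_pos hr1 hq1) j.succ_pos, ?_, ?_⟩
  · push_cast
    calc (r : ℝ) * q * (j + 1) ≤ (K ^ 2 * K ^ A) * K ^ (5 * C) * K ^ j := by
          gcongr
          · refine hr2.trans ?_
            gcongr
            exact hnum 2 (by norm_num)
          · exact natCast_succ_le_pow hK j
      _ = K ^ (2 + A + 5 * C + j) := by simp only [pow_add]
      _ ≤ _ := hpow (by omega)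
  · have heq : ((r * q * (j + 1) : ℕ) : ℝ) * g.coeff (j + 1) =
        r * (q * ((j + 1) * g.coeff (j + 1))) := by push_cast; ring
    rw [heq, pow_succ' (H : ℝ), ← mul_assoc]
    calc _ ≤ 1188 * (K ^ A) ^ 4 * ε * (H : ℝ) ^ j := by gcongr
      _ = 1188 * (K ^ A) ^ 4 * K ^ A := by simp only [ε]; field_simp
      _ ≤ K ^ 11 * (K ^ A) ^ 4 * K ^ A := by gcongr; exact hnum 11 (by norm_num)
      _ = K ^ (5 * A + 11) := by rw [← pow_mul, ← pow_add, ← pow_add]; congr 1; omega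
      _ ≤ _ := hpow (by omega)

theorem exists_leadingCoeffBound {j : ℕ} (hj : 1 ≤ j) : ∃ C, LeadingCoeffBound j C := by
  induction j, hj using Nat.le_induction with
  | base => exact ⟨1, leadingCoeffBound_one⟩
  | succ j hj ih => exact ih.choose_spec.succ hj

/-! ### Restriction to short progressions -/

theorem norm_sum_shift_sub_le (F : ℕ → ℂ) (hF : ∀ n, ‖F n‖ = 1) (N s : ℕ) :
    ‖∑ x ∈ range N, F x - ∑ x ∈ range N, F (x + s)‖ ≤ 2 * s := by
  induction s with
  | zero => simp
  | succ s ih =>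
    have h1 := sum_range_succ (fun x => F (x + s)) N
    rw [sum_range_succ'] at h1
    have h2 : ∑ x ∈ range N, F x - ∑ x ∈ range N, F (x + (s + 1)) =
        (∑ x ∈ range N, F x - ∑ x ∈ range N, F (x + s)) + (F (0 + s) - F (N + s)) := by
      simp only [add_assoc, add_comm 1 s] at h1 ⊢
      linear_combination -h1
    rw [h2]
    refine (norm_add_le _ _).trans ?_
    have h3 := norm_sub_le (F (0 + s)) (F (N + s))
    rw [hF, hF] at h3
    push_cast
    linarith

/-- A long sum is controlled by one of the short sums along a progression of difference `Q`. -/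
theorem exists_norm_sum_progression_ge (F : ℕ → ℂ) (hF : ∀ n, ‖F n‖ = 1) {N : ℕ} (hN : 1 ≤ N)
    (Q H : ℕ) : ∃ x ∈ Icc 1 N, H * ‖∑ x ∈ Icc 1 N, F x‖ ≤
      N * ‖∑ h ∈ range H, F (x + Q * h)‖ + 2 * Q * (H : ℝ) ^ 2 := by
  have hIcc : ∀ G : ℕ → ℂ, ∑ x ∈ Icc 1 N, G x = ∑ x ∈ range N, G (x + 1) := by
    intro G
    rw [range_eq_Ico, sum_Ico_add' G 0 N 1]
    rfl
  set S := ∑ x ∈ Icc 1 N, F x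
  have hshift : ∀ h ∈ range H, ‖S - ∑ x ∈ Icc 1 N, F (x + Q * h)‖ ≤ 2 * Q * H := by
    intro h hh
    rw [hIcc, show S = _ from hIcc F]
    have h1 := norm_sum_shift_sub_le (fun x => F (x + 1)) (fun _ => hF _) N (Q * h)
    simp only [add_right_comm _ _ 1] at h1 ⊢
    refine h1.trans ?_
    have : (h : ℝ) ≤ H := by exact_mod_cast (mem_range.1 hh).le
    push_cast
    rw [← mul_assoc]
    gcongr
  obtain ⟨x, hx, hmax⟩ := exists_max_image (Icc 1 N)
    (fun x => ‖∑ h ∈ range H, F (x + Q * h)‖) ⟨1, mem_Icc.2 ⟨le_rfl, hN⟩⟩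
  refine ⟨x, hx, ?_⟩
  -- Average the sum over its `H` translates by `Q * h`, paying for the boundary terms.
  have h1 : (H : ℂ) * S = ∑ y ∈ Icc 1 N, ∑ h ∈ range H, F (y + Q * h) +
      ∑ h ∈ range H, (S - ∑ y ∈ Icc 1 N, F (y + Q * h)) := by
    rw [sum_comm, ← sum_add_distrib]
    simp
  have h2 : H * ‖S‖ = ‖(H : ℂ) * S‖ := by simp
  rw [h2, h1]
  refine (norm_add_le _ _).trans (add_le_add ?_ ?_)
  · refine (norm_sum_le _ _).trans ((sum_le_card_nsmul _ _ _ hmax).trans ?_)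
    simp
  · refine (norm_sum_le _ _).trans ((sum_le_card_nsmul _ _ _ hshift).trans (le_of_eq ?_))
    simp
    ring

theorem coeff_taylor_eq_sum {k : ℕ} {f : ℝ[X]} (hf : f.natDegree ≤ k) (x : ℝ) (i : ℕ) :
    (taylor x f).coeff i =
      ∑ n ∈ range (k + 1), ((n + i).choose i : ℝ) * f.coeff (n + i) * x ^ n := by
  have hd : (hasseDeriv i f).natDegree < k + 1 := by
    have := natDegree_hasseDeriv_le f i
    omega
  rw [taylor_coeff, eval_eq_sum_range' hd]
  simp [hasseDeriv_coeff]

/-- One of the `i ≥ 1` factors `Q` clears the denominator of `b`; everything else is an integer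
multiplier, and `x ^ n ≤ N ^ n` is paid for by the surplus in the hypothesis. -/
theorem distInt_taylor_term_le {Q x N i n : ℕ} (hi : 1 ≤ i) (hx : x ≤ N) {b B : ℝ}
    (hb : distInt (Q * b) * (N : ℝ) ^ (n + i) ≤ B) :
    distInt ((Q : ℝ) ^ i * (((n + i).choose i : ℝ) * b * (x : ℝ) ^ n)) * (N : ℝ) ^ i ≤
      (Q : ℝ) ^ (i - 1) * 2 ^ (n + i) * B := by
  have heq : (Q : ℝ) ^ i * (((n + i).choose i : ℝ) * b * (x : ℝ) ^ n) =
      ((Q ^ (i - 1) * (n + i).choose i * x ^ n : ℕ) : ℝ) * (Q * b) := by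
    obtain ⟨i, rfl⟩ := Nat.exists_eq_add_of_le' hi
    push_cast
    simp only [pow_succ]
    ring
  have hd := distInt_nonneg (Q * b)
  have hch : ((n + i).choose i : ℝ) ≤ 2 ^ (n + i) := by exact_mod_cast Nat.choose_le_two_pow _ _
  have hxN : (x : ℝ) ≤ N := by exact_mod_cast hx
  rw [heq]
  calc _ ≤ ((Q ^ (i - 1) * (n + i).choose i * x ^ n : ℕ) * distInt (Q * b)) * (N : ℝ) ^ i := by
        gcongr
        exact distInt_natCast_mul_le _ _
    _ ≤ ((Q : ℝ) ^ (i - 1) * 2 ^ (n + i) * (N : ℝ) ^ n) * distInt (Q * b) * (N : ℝ) ^ i := by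
        push_cast
        gcongr
    _ = (Q : ℝ) ^ (i - 1) * 2 ^ (n + i) * (distInt (Q * b) * (N : ℝ) ^ (n + i)) := by
        rw [pow_add]; ring
    _ ≤ _ := by gcongr

theorem distInt_taylor_tail_le {Q x N i k : ℕ} (hQ : 1 ≤ Q) (hi : 1 ≤ i) (hik : i ≤ k)
    (hx : x ≤ N) {f : ℝ[X]} {B : ℝ} (hB : 0 ≤ B) {s : Finset ℕ} (hs : s ⊆ range (k + 1))
    (hb : ∀ n ∈ s, distInt (Q * f.coeff (n + i)) * (N : ℝ) ^ (n + i) ≤ B) :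
    distInt ((Q : ℝ) ^ i * ∑ n ∈ s, ((n + i).choose i : ℝ) * f.coeff (n + i) * (x : ℝ) ^ n) *
      (N : ℝ) ^ i ≤ (k + 1) * ((Q : ℝ) ^ k * 2 ^ (2 * k) * B) := by
  have hQ' : (1 : ℝ) ≤ Q := by exact_mod_cast hQ
  rw [mul_sum]
  calc _ ≤ (∑ n ∈ s, distInt ((Q : ℝ) ^ i *
          (((n + i).choose i : ℝ) * f.coeff (n + i) * (x : ℝ) ^ n))) * (N : ℝ) ^ i := by
        gcongr
        exact distInt_sum_le _ _
    _ = ∑ n ∈ s, distInt ((Q : ℝ) ^ i *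
          (((n + i).choose i : ℝ) * f.coeff (n + i) * (x : ℝ) ^ n)) * (N : ℝ) ^ i := by
        rw [sum_mul]
    _ ≤ ∑ n ∈ s, (Q : ℝ) ^ k * 2 ^ (2 * k) * B := by
        refine sum_le_sum fun n hn => (distInt_taylor_term_le hi hx (hb n hn)).trans ?_
        have := mem_range.1 (hs hn)
        gcongr
        · omega
        · norm_num
        · omega
    _ ≤ _ := by
        rw [sum_const, nsmul_eq_mul]
        gcongr
        have := card_le_card hs
        rw [card_range] at this
        exact_mod_cast this

/-- If the coefficients of `f` of degree more than `j` are close to rational numbers of denominator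
`Q`, then on short progressions of difference `Q` the polynomial `f` is close, modulo one, to a
polynomial of degree `j`. -/
theorem exists_poly_near_on_progression {Q x N H j k : ℕ} (hQ : 1 ≤ Q) (hj : 1 ≤ j) (hjk : j ≤ k)
    (hx : x ≤ N) (hHN : H ≤ N) (hN : 1 ≤ N) {f : ℝ[X]} (hf : f.natDegree ≤ k) {B : ℝ} (hB : 0 ≤ B)
    (hb : ∀ l, j + 1 ≤ l → distInt (Q * f.coeff l) * (N : ℝ) ^ l ≤ B) :
    ∃ g : ℝ[X], g.natDegree ≤ j ∧ g.coeff j = (Q : ℝ) ^ j * f.coeff j ∧ ∀ h ∈ range H,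
      distInt (f.eval ((x + Q * h : ℕ) : ℝ) - g.eval (h : ℝ)) * N ≤
        (k + 1) * ((k + 1) * ((Q : ℝ) ^ k * 2 ^ (2 * k) * B)) * H := by
  set c : ℕ → ℝ := fun i => (Q : ℝ) ^ i * (taylor (x : ℝ) f).coeff i with hc
  set b := (Q : ℝ) ^ j * f.coeff j
  -- Coefficients below `j` are kept exactly. That of degree `j` is replaced by `b`, free of `x`:
  -- the correction, like the coefficients above `j`, involves only the `f.coeff l` with `l > j`, so
  -- it is nearly an integer.
  set g : ℝ[X] := ∑ i ∈ range j, C (c i) * X ^ i + C b * X ^ j with hg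
  set δ : ℕ → ℝ := fun i => if i = j then c j - b else c i with hδ
  have hlow : (∑ i ∈ range j, C (c i) * X ^ i).degree < (j : WithBot ℕ) := by
    rw [← mem_degreeLT]
    refine Submodule.sum_mem _ fun i hi => mem_degreeLT.2 ?_
    exact (degree_C_mul_X_pow_le _ _).trans_lt (by exact_mod_cast mem_range.1 hi)
  have hev : ∀ h : ℕ, f.eval ((x + Q * h : ℕ) : ℝ) - g.eval (h : ℝ) =
      ∑ i ∈ Ico j (k + 1), ((h ^ i : ℕ) : ℝ) * δ i := by
    intro h
    have h1 : f.eval ((x + Q * h : ℕ) : ℝ) = ∑ i ∈ range (k + 1), c i * (h : ℝ) ^ i := by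
      have hd : (taylor (x : ℝ) f).natDegree < k + 1 := by rw [natDegree_taylor]; omega
      rw [show ((x + Q * h : ℕ) : ℝ) = (Q * h : ℝ) + x by push_cast; ring, ← taylor_eval,
        eval_eq_sum_range' hd]
      refine sum_congr rfl fun i _ => ?_
      simp only [hc]
      rw [mul_pow]; ring
    have h2 : ∑ i ∈ Ico j (k + 1), ((h ^ i : ℕ) : ℝ) * δ i =
        ∑ i ∈ Ico j (k + 1), c i * (h : ℝ) ^ i - b * (h : ℝ) ^ j := by
      have hjk' : j < k + 1 := by omega
      rw [sum_eq_sum_Ico_succ_bot hjk', sum_eq_sum_Ico_succ_bot hjk']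
      have h3 : ∑ i ∈ Ico (j + 1) (k + 1), ((h ^ i : ℕ) : ℝ) * δ i =
          ∑ i ∈ Ico (j + 1) (k + 1), c i * (h : ℝ) ^ i := by
        refine sum_congr rfl fun i hi => ?_
        have : i ≠ j := by have := mem_Ico.1 hi; omega
        simp only [hδ, if_neg this, Nat.cast_pow]
        ring
      rw [h3]
      simp only [hδ, if_pos rfl, Nat.cast_pow]
      ring
    rw [h1, h2, hg, eval_add, eval_finsetSum, ← sum_range_add_sum_Ico _ (show j ≤ k + 1 by omega)]
    simp
  set D := ((k : ℝ) + 1) * ((Q : ℝ) ^ k * 2 ^ (2 * k) * B)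
  have hD : 0 ≤ D := by positivity
  have hδD : ∀ i ∈ Ico j (k + 1), distInt (δ i) * (N : ℝ) ^ i ≤ D := by
    intro i hi
    have hi' := mem_Ico.1 hi
    by_cases hij : i = j
    · subst hij
      have h1 : δ i = (Q : ℝ) ^ i *
          ∑ n ∈ Ico 1 (k + 1), ((n + i).choose i : ℝ) * f.coeff (n + i) * (x : ℝ) ^ n := by
        simp only [hδ, if_pos rfl, hc]
        rw [coeff_taylor_eq_sum hf, range_eq_Ico, sum_eq_sum_Ico_succ_bot (by omega)]
        simp [b]
        ring
      rw [h1]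
      exact distInt_taylor_tail_le hQ hj hjk hx hB (fun n hn => mem_range.2 (mem_Ico.1 hn).2)
        fun n hn => hb _ (by have := mem_Ico.1 hn; omega)
    · simp only [hδ, if_neg hij, hc]
      rw [coeff_taylor_eq_sum hf]
      exact distInt_taylor_tail_le hQ (by omega) (by omega) hx hB Subset.rfl
        fun n hn => hb _ (by omega)
  refine ⟨g, ?_, ?_, ?_⟩
  · refine natDegree_le_of_degree_le ((degree_add_le _ _).trans (max_le hlow.le ?_))
    exact degree_C_mul_X_pow_le _ _
  · rw [hg, coeff_add, coeff_eq_zero_of_degree_lt hlow]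
    simp
  · intro h hh
    have hhH : (h : ℝ) ≤ H := by exact_mod_cast (mem_range.1 hh).le
    have hN0 : (0 : ℝ) < N := by exact_mod_cast hN
    have hHN' : (H : ℝ) ≤ N := by exact_mod_cast hHN
    rw [hev]
    calc _ ≤ (∑ i ∈ Ico j (k + 1), distInt (((h ^ i : ℕ) : ℝ) * δ i)) * N := by
          gcongr
          exact distInt_sum_le _ _
      _ = ∑ i ∈ Ico j (k + 1), distInt (((h ^ i : ℕ) : ℝ) * δ i) * N := by rw [sum_mul]
      _ ≤ ∑ i ∈ Ico j (k + 1), D * H := by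
          refine sum_le_sum fun i hi => ?_
          obtain ⟨i', rfl⟩ := Nat.exists_eq_add_of_le' (hj.trans (mem_Ico.1 hi).1)
          have h0 := distInt_nonneg (δ (i' + 1))
          calc _ ≤ ((h ^ (i' + 1) : ℕ) * distInt (δ (i' + 1))) * N := by
                gcongr
                exact distInt_natCast_mul_le _ _
            _ = (h : ℝ) ^ i' * h * distInt (δ (i' + 1)) * N := by push_cast; ring
            _ ≤ (N : ℝ) ^ i' * H * distInt (δ (i' + 1)) * N := by
                gcongr
                exact_mod_cast hhH.trans hHN'
            _ = distInt (δ (i' + 1)) * (N : ℝ) ^ (i' + 1) * H := by ring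
            _ ≤ D * H := by gcongr; exact hδD _ hi
      _ ≤ _ := by
          rw [sum_const, nsmul_eq_mul, Nat.card_Ico, ← mul_assoc]
          gcongr
          exact_mod_cast Nat.sub_le _ _

/-! ### All coefficients of positive degree -/

/-- If an exponential sum over a polynomial of degree at most `k` is within a factor `K` of being
trivially large, then the coefficients of degree at least `j` are simultaneously well approximated
by rational numbers whose common denominator is at most a power of `K`. -/
def UpperCoeffBound (k j C : ℕ) : Prop :=
  ∀ K : ℝ, 2 ≤ K → ∀ N : ℕ, 1 ≤ N → ∀ f : ℝ[X], f.natDegree ≤ k →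
    (N : ℝ) ≤ K * ‖∑ x ∈ Icc 1 N, expChar (f.eval (x : ℝ))‖ →
    ∃ q : ℕ, 1 ≤ q ∧ (q : ℝ) ≤ K ^ C ∧
      ∀ i, j ≤ i → distInt (q * f.coeff i) * (N : ℝ) ^ i ≤ K ^ C

theorem upperCoeffBound_succ_self (k : ℕ) : UpperCoeffBound k (k + 1) 0 := by
  intro K _ N _ f hf _
  refine ⟨1, le_rfl, by simp, fun i hi => ?_⟩
  rw [coeff_eq_zero_of_natDegree_lt (by omega)]
  simp [distInt_zero]

/-- On progressions of difference `Q`, the denominator already found, the polynomial is modulo one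
nearly of degree `j` with leading coefficient `Q ^ j * f.coeff j`, so the leading-coefficient bound
applies. -/
theorem UpperCoeffBound.pred {k j C : ℕ} (hj : 1 ≤ j) (hjk : j ≤ k)
    (hC : UpperCoeffBound k (j + 1) C) : ∃ C', UpperCoeffBound k j C' := by
  obtain ⟨A, hA⟩ := exists_leadingCoeffBound hj
  -- The exponent collects the error constants of the approximation on progressions, and `6` more
  -- makes that error at most `1 / K ^ 6`.
  set D := 2 * k + (C * k + 2 * k + C) + 6
  refine ⟨D * k + 3 * A + C * j + C + (D + 1) * j, ?_⟩
  intro K hK N hN f hf hS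
  have hK1 : 1 ≤ K := by linarith
  have hpow : ∀ {a b : ℕ}, a ≤ b → K ^ a ≤ K ^ b := fun h => pow_le_pow_right₀ hK1 h
  have hN1 : (1 : ℝ) ≤ N := by exact_mod_cast hN
  rcases lt_or_ge (N : ℝ) (K ^ D) with hsmall | hbig
  · refine ⟨1, le_rfl, by simpa using one_le_pow₀ hK1, fun i _ => ?_⟩
    rcases lt_or_ge k i with hi | hi
    · rw [coeff_eq_zero_of_natDegree_lt (by omega)]
      simp only [mul_zero, distInt_zero, zero_mul]
      positivity
    · calc distInt ((1 : ℕ) * f.coeff i) * (N : ℝ) ^ i ≤ 1 * (K ^ D) ^ k := by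
            gcongr
            · exact (distInt_le_half _).trans (by norm_num)
            · exact (pow_le_pow_right₀ hN1 hi).trans (by gcongr)
        _ = K ^ (D * k) := by rw [one_mul, pow_mul]
        _ ≤ _ := hpow (by omega)
  obtain ⟨Q, hQ1, hQ2, hQ3⟩ := hC K hK N hN f hf hS
  set H := ⌊(N : ℝ) / K ^ D⌋₊
  have hHle : (H : ℝ) ≤ N / K ^ D := Nat.floor_le (by positivity)
  have hH1 : 1 ≤ H := Nat.le_floor (by
    rw [Nat.cast_one, le_div_iff₀ (by positivity)]; linarith)
  have hH1' : (1 : ℝ) ≤ H := by exact_mod_cast hH1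
  have hHN : H ≤ N := by
    have : (H : ℝ) ≤ N := hHle.trans (div_le_self (by positivity) (one_le_pow₀ hK1))
    exact_mod_cast this
  rw [le_div_iff₀ (by positivity)] at hHle
  have hNH : (N : ℝ) ≤ K ^ (D + 1) * H := by
    have h1 : (N : ℝ) / K ^ D < H + 1 := Nat.lt_floor_add_one _
    have h2 : (N : ℝ) / K ^ D ≤ K * H := by nlinarith
    rw [div_le_iff₀ (by positivity)] at h2
    rw [pow_succ]; linarith
  obtain ⟨x, hx, hxS⟩ := exists_norm_sum_progression_ge (fun x => expChar (f.eval (x : ℝ)))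
    (fun _ => norm_expChar _) hN Q H
  obtain ⟨g, hgdeg, hgj, hg⟩ := exists_poly_near_on_progression hQ1 hj hjk (mem_Icc.1 hx).2 hHN hN
    hf (by positivity) hQ3
  set S := ‖∑ x ∈ Icc 1 N, expChar (f.eval (x : ℝ))‖
  set T := ‖∑ h ∈ range H, expChar (f.eval ((x + Q * h : ℕ) : ℝ))‖
  have hT : (H : ℝ) ≤ 2 * K * T := by
    have h1 : 4 * K * Q * H ≤ N := by
      calc 4 * K * Q * H ≤ K ^ 2 * K * K ^ C * H := by
            gcongr
            nlinarith
        _ = K ^ (C + 3) * H := by ring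
        _ ≤ K ^ D * H := mul_le_mul_of_nonneg_right (hpow (by omega)) (by linarith)
        _ ≤ N := by linarith
    have h2 : H * N ≤ K * (N * T + 2 * Q * (H : ℝ) ^ 2) := by
      calc H * N ≤ (H : ℝ) * (K * S) := by gcongr
        _ = K * (H * S) := by ring
        _ ≤ _ := by gcongr
    have h3 : 4 * K * Q * H * H ≤ N * H := by gcongr
    refine le_of_mul_le_mul_right ?_ (by linarith : (0 : ℝ) < N)
    nlinarith
  have hnear : ∀ h ∈ range H, distInt (f.eval ((x + Q * h : ℕ) : ℝ) - g.eval (h : ℝ)) ≤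
      1 / K ^ 6 := by
    intro h hh
    rw [le_div_iff₀ (by positivity)]
    refine le_of_mul_le_mul_right ?_ (by linarith : (0 : ℝ) < N)
    calc _ = (distInt (f.eval ((x + Q * h : ℕ) : ℝ) - g.eval (h : ℝ)) * N) * K ^ 6 := by ring
      _ ≤ ((k + 1) * ((k + 1) * ((Q : ℝ) ^ k * 2 ^ (2 * k) * K ^ C)) * H) * K ^ 6 := by
          exact mul_le_mul_of_nonneg_right (hg h hh) (by positivity)
      _ ≤ (K ^ k * (K ^ k * ((K ^ C) ^ k * K ^ (2 * k) * K ^ C)) * H) * K ^ 6 := by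
          gcongr
          · exact natCast_succ_le_pow hK k
          · exact natCast_succ_le_pow hK k
      _ = H * K ^ D := by rw [← pow_mul]; simp only [D]; ring
      _ ≤ 1 * N := by linarith
  set U := ‖∑ h ∈ range H, expChar (g.eval (h : ℝ))‖
  have hU : (H : ℝ) ≤ K ^ 3 * U := by
    have h1 : T ≤ U + H * (8 * (1 / K ^ 6)) := by
      have h2 : ‖∑ h ∈ range H, (expChar (f.eval ((x + Q * h : ℕ) : ℝ)) -
          expChar (g.eval (h : ℝ)))‖ ≤ H * (8 * (1 / K ^ 6)) := by
        refine (norm_sum_le _ _).trans ((sum_le_card_nsmul _ _ (8 * (1 / K ^ 6))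
          fun h hh => ?_).trans_eq ?_)
        · refine (norm_expChar_sub_le _ _).trans ?_
          exact mul_le_mul (by linarith [Real.pi_lt_four]) (hnear h hh) (distInt_nonneg _)
            (by norm_num)
        · simp
      rw [sum_sub_distrib] at h2
      linarith [norm_le_norm_add_norm_sub' (∑ h ∈ range H, expChar (f.eval ((x + Q * h : ℕ) : ℝ)))
        (∑ h ∈ range H, expChar (g.eval (h : ℝ)))]
    have h3 : 2 * K * (H * (8 * (1 / K ^ 6))) ≤ H / 2 := by
      have h4 : (2 : ℝ) ^ 5 ≤ K ^ 5 := by gcongr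
      have h5 : 2 * K * (H * (8 * (1 / K ^ 6))) = 16 * H / K ^ 5 := by field_simp; ring
      rw [h5, div_le_iff₀ (by positivity)]
      nlinarith
    have h6 : (H : ℝ) ≤ 4 * K * U := by nlinarith
    refine h6.trans (mul_le_mul_of_nonneg_right ?_ (norm_nonneg _))
    calc 4 * K = 2 ^ 2 * K := by norm_num
      _ ≤ K ^ 2 * K := by gcongr
      _ = K ^ 3 := by ring
  obtain ⟨r, hr1, hr2, hr3⟩ := hA (K ^ 3) (by nlinarith [pow_le_pow_left₀ zero_le_two hK 3])
    H hH1 g hgdeg hU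
  rw [← pow_mul] at hr2 hr3
  rw [hgj] at hr3
  -- All `j` factors `Q` are needed in degree `j`; in higher degrees one suffices and the rest are a
  -- harmless multiplier.
  refine ⟨r * Q ^ j, Nat.mul_pos hr1 (Nat.pow_pos hQ1), ?_, fun i hi => ?_⟩
  · push_cast
    calc (r : ℝ) * Q ^ j ≤ K ^ (3 * A) * (K ^ C) ^ j := by gcongr
      _ = K ^ (3 * A + C * j) := by rw [← pow_mul, ← pow_add]
      _ ≤ _ := hpow (by omega)
  rcases hi.eq_or_lt with rfl | hi
  · have heq : ((r * Q ^ j : ℕ) : ℝ) * f.coeff j = r * ((Q : ℝ) ^ j * f.coeff j) := by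
      push_cast; ring
    have hd := distInt_nonneg (r * ((Q : ℝ) ^ j * f.coeff j))
    rw [heq]
    calc _ ≤ distInt (r * ((Q : ℝ) ^ j * f.coeff j)) * (K ^ (D + 1) * H) ^ j := by gcongr
      _ = K ^ ((D + 1) * j) * (distInt (r * ((Q : ℝ) ^ j * f.coeff j)) * (H : ℝ) ^ j) := by
          rw [mul_pow, ← pow_mul]; ring
      _ ≤ K ^ ((D + 1) * j) * K ^ (3 * A) := by gcongr
      _ = K ^ ((D + 1) * j + 3 * A) := by rw [← pow_add]
      _ ≤ _ := hpow (by omega)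
  · have heq : ((r * Q ^ j : ℕ) : ℝ) * f.coeff i =
        ((r * Q ^ (j - 1) : ℕ) : ℝ) * (Q * f.coeff i) := by
      obtain ⟨j, rfl⟩ := Nat.exists_eq_add_of_le' hj
      push_cast
      simp only [pow_succ]
      ring
    have hQr : (1 : ℝ) ≤ Q := by exact_mod_cast hQ1
    rw [heq]
    calc _ ≤ ((r * Q ^ (j - 1) : ℕ) * distInt (Q * f.coeff i)) * (N : ℝ) ^ i := by
          gcongr
          exact distInt_natCast_mul_le _ _
      _ = (r * (Q : ℝ) ^ (j - 1)) * (distInt (Q * f.coeff i) * (N : ℝ) ^ i) := by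
          push_cast; ring
      _ ≤ (K ^ (3 * A) * (K ^ C) ^ j) * K ^ C := by
          gcongr
          · exact mul_nonneg (distInt_nonneg _) (by positivity)
          · exact (pow_le_pow_right₀ hQr (Nat.sub_le j 1)).trans (by gcongr)
          · exact hQ3 i hi
      _ = K ^ (3 * A + C * j + C) := by rw [← pow_mul, ← pow_add, ← pow_add]
      _ ≤ _ := hpow (by omega)

theorem exists_upperCoeffBound_one (k : ℕ) : ∃ C, UpperCoeffBound k 1 C := by
  have h : ∀ n ≤ k, ∃ C, UpperCoeffBound k (k + 1 - n) C := by
    intro n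
    induction n with
    | zero => exact fun _ => ⟨0, upperCoeffBound_succ_self k⟩
    | succ n ih =>
      intro hn
      obtain ⟨C, hC⟩ := ih (by omega)
      rw [show k + 1 - n = (k + 1 - (n + 1)) + 1 by omega] at hC
      exact hC.pred (by omega) (by omega)
  simpa using h k le_rfl

/-! ### Non-Liouville numbers and conclusion -/

/-- A non-Liouville number has no good rational approximations. -/
theorem exists_one_lt_pow_mul_distInt {α : ℝ} (hα : ¬ IsLiouvilleNumber α) :
    ∃ n : ℕ, ∀ q : ℕ, 1 ≤ q → 1 < (2 * q : ℝ) ^ n * distInt (q * α) := by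
  simp only [IsLiouvilleNumber, not_forall, not_exists, not_and, not_le] at hα
  obtain ⟨n, hn⟩ := hα
  refine ⟨n, fun q hq => ?_⟩
  have hq' : (1 : ℝ) ≤ q := by exact_mod_cast hq
  -- Doubling numerator and denominator meets the condition `1 < q` even when `q = 1`.
  have h := hn (2 * round (q * α)) (2 * q) (by omega)
  rw [zpow_neg, zpow_natCast, inv_lt_iff_one_lt_mul₀ (by push_cast; positivity)] at h
  push_cast at h
  refine h.trans_le ?_
  rw [distInt_eq]
  have h2 : α - 2 * (round (q * α) : ℝ) / (2 * q) = (q * α - round (q * α)) / q := by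
    field_simp
  rw [h2, abs_div, Nat.abs_cast, mul_comm (_ / _)]
  exact mul_le_mul_of_nonneg_left (div_le_self (abs_nonneg _) hq') (by positivity)

theorem theorem2p1 (P : Polynomial ℝ) (hα : ¬ IsLiouvilleNumber (P.coeff 1)) :
    ∃ τ ρ X₀ : ℝ, 0 < τ ∧ 0 < ρ ∧ 0 < X₀ ∧
      ∀ d : ℕ, 1 ≤ d → ∀ X : ℝ, X₀ ≤ X → ∀ m : ℕ, 1 ≤ m → (m : ℝ) < X ^ ρ →
        ‖weylSum P d m X‖ ≤ X ^ (1 - τ) := by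
  obtain ⟨C, hC⟩ := exists_upperCoeffBound_one P.natDegree
  obtain ⟨n, hn⟩ := exists_one_lt_pow_mul_distInt hα
  -- With `K = X ^ (1 / E)`, the final chain loses `K` from `X ≤ K * N`, `K ^ ((C + 2) * n)` from
  -- `(2 * q * m) ^ n`, and `K ^ C` from the approximation. `X₀ = 2 ^ E` gives `2 ≤ K`.
  set E := C + (C + 2) * n + 1
  have hE : (0 : ℝ) < (E : ℝ)⁻¹ := inv_pos.2 (by simp only [E]; positivity)
  refine ⟨(E : ℝ)⁻¹, (E : ℝ)⁻¹, 2 ^ E, hE, hE, by positivity, ?_⟩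
  intro d hd X hX m hm hmX
  by_contra! hlarge
  have hX0 : 0 < X := lt_of_lt_of_le (by positivity) hX
  have hX2 : 2 ≤ X := le_trans (le_self_pow₀ one_le_two (by omega)) hX
  set K := X ^ (E : ℝ)⁻¹
  have hKE : K ^ E = X := Real.rpow_inv_natCast_pow hX0.le (by omega)
  have hK : 2 ≤ K := by
    rw [← hKE] at hX
    exact le_of_pow_le_pow_left₀ (by omega) (by positivity) hX
  have hd0 : (d : ℝ) ≠ 0 := by
    rw [Nat.cast_ne_zero]; omega
  set f : ℝ[X] := Polynomial.C ((m : ℝ) / d) * P.comp (Polynomial.C (d : ℝ) * Polynomial.X) with hf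
  have hfdeg : f.natDegree ≤ P.natDegree := by
    refine (natDegree_C_mul_le _ _).trans (natDegree_comp_le.trans ?_)
    rw [natDegree_C_mul_X _ hd0, mul_one]
  have hf1 : f.coeff 1 = m * P.coeff 1 := by
    rw [hf, coeff_C_mul, comp_C_mul_X_coeff]
    field_simp
  have hsum : weylSum P d m X = ∑ x ∈ Icc 1 ⌊X⌋₊, expChar (f.eval (x : ℝ)) := by
    refine sum_congr rfl fun x _ => ?_
    congr 1
    simp [hf]
    ring
  rw [hsum] at hlarge
  set N := ⌊X⌋₊
  have hNX : (N : ℝ) ≤ X := Nat.floor_le hX0.le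
  have hN1 : 1 ≤ N := Nat.le_floor (by push_cast; linarith)
  have hXN : X ≤ K * N := by
    have h1 : X < N + 1 := Nat.lt_floor_add_one X
    have h2 : (1 : ℝ) ≤ N := by exact_mod_cast hN1
    nlinarith
  obtain ⟨q, hq1, hq2, hq3⟩ := hC K hK N hN1 f hfdeg (by
    calc (N : ℝ) ≤ X := hNX
      _ = K * X ^ (1 - (E : ℝ)⁻¹) := by rw [← Real.rpow_add hX0]; simp
      _ ≤ _ := by gcongr)
  have h1 := hq3 1 le_rfl
  rw [hf1, pow_one, ← mul_assoc, ← Nat.cast_mul] at h1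
  have h2 := hn (q * m) (Nat.mul_pos hq1 hm)
  have h3 : X < X := by
    calc X = X * 1 := (mul_one X).symm
      _ < X * ((2 * (q * m : ℕ) : ℝ) ^ n * distInt ((q * m : ℕ) * P.coeff 1)) := by gcongr
      _ ≤ (K * N) * ((2 * (q * m : ℕ) : ℝ) ^ n * distInt ((q * m : ℕ) * P.coeff 1)) := by
          gcongr
      _ = K * (2 * (q * m : ℕ) : ℝ) ^ n * (distInt ((q * m : ℕ) * P.coeff 1) * N) := by ring
      _ ≤ K * (K * (K ^ C * K)) ^ n * K ^ C := by
          push_cast at h1 ⊢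
          gcongr
          exact mul_nonneg (distInt_nonneg _) (by positivity)
      _ = K ^ E := by
          rw [show K * (K ^ C * K) = K ^ (C + 2) by ring, ← pow_mul]
          simp only [E]; ring
      _ = X := hKE
  exact h3.false
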